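/- A cardinal $m$ is called non-measurable if, for a set $X$ of cardinality $m$, the only countably additive measure defined on all subsets of $X$, taking only the values $0$ and $1$ and vanishing on all one-point sets, is the zero measure; otherwise $m$ is called measurable. A gyrogroup is a set $G$ with a binary operation $\oplus$ such that: there is a (unique) two-sided identity $0$; each $x\in G$ has a unique two-sided inverse $\ominus x$; for all $x,y\in G$ there is an automorphism $\mathrm{gyr}[x,y]$ of $(G,\oplus)$ with $x\oplus(y\oplus z)=(x\oplus y)\oplus \mathrm{gyr}[x,y](z)$ for all $z\in G$; and $\mathrm{gyr}[x\oplus y,y]=\mathrm{gyr}[x,y]$ for all $x,y\in G$. A strongly topological gyrogroup is a gyrogroup $G$ with a topology such that $\oplus: G\times G\to G$ and $\ominus: G\to G$ are continuous and $0$ has a neighborhood base $\mathscr U$ such that $\mathrm{gyr}[x,y](U)=U$ for all $U\in\mathscr U$ and $x,y\in G$. A topological space is submaximal if each of its dense subsets is open. It is hereditarily paracompact if each of its subspaces is paracompact and Hausdorff. For a topological space $X$, $\dim X$ denotes the covering dimension, defined by finite functionally open covers (a set is functionally open if it has the form $\{x: f(x)\neq 0\}$ for some continuous $f:X\to\mathbb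 R$): $\dim X\le n$ if every finite functionally open cover of $X$ has a finite functionally open refinement covering $X$ in which any $n+2$ distinct members have empty intersection. Suppose that there are no measurable cardinals. Then every Hausdorff submaximal strongly topological gyrogroup $G$ is hereditarily paracompact and satisfies $\dim G=0$. In particular, no infinite Hausdorff submaximal strongly topological gyrogroup is connected. -/

import Mathlib

open Set Topology MeasureTheory

universe u

/-- A cardinal `m` is non-measurable if, for every set `X` of cardinality `m`, the only countably
additive measure on all subsets of `X` that takes only the values `0` and `1` and vanishes on all
one-point sets is the zero measure. -/
def IsNonmeasurableCardinal (m : Cardinal.{u}) : Prop :=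
  ∀ X : Type u, Cardinal.mk X = m → ∀ μ : @Measure X ⊤,
    (∀ s : Set X, μ s = 0 ∨ μ s = 1) → (∀ x : X, μ {x} = 0) → μ = 0

/-- A cardinal is measurable if it is not non-measurable. -/
def IsMeasurableCardinal (m : Cardinal.{u}) : Prop :=
  ¬ IsNonmeasurableCardinal m

/-- A gyrogroup, written additively: `x + y` is `x ⊕ y` and `-x` is `⊖x`.  (The two-sided identity
of an `AddZeroClass` is automatically unique.)  `G ≃+ G` is the type of automorphisms of the
groupoid `(G, ⊕)`. -/
class Gyrogroup (G : Type u) extends AddZeroClass G, Neg G where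
  neg_add_self (x : G) : -x + x = 0
  add_neg_self (x : G) : x + -x = 0
  neg_unique (x y : G) : y + x = 0 → x + y = 0 → y = -x
  /-- The gyroautomorphism `gyr[x, y]`. -/
  gyr : G → G → G ≃+ G
  add_add_gyr (x y z : G) : x + (y + z) = (x + y) + gyr x y z
  gyr_add_left (x y : G) : gyr (x + y) y = gyr x y

/-- A topological gyrogroup: `⊕` is jointly continuous and `⊖` is continuous. -/
class IsTopologicalGyrogroup (G : Type u) [TopologicalSpace G] [Gyrogroup G] : Prop
    extends ContinuousAdd G, ContinuousNeg G

/-- A strongly topological gyrogroup: a topological gyrogroup in which `0` has a neighborhood base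
whose members are invariant under all gyrations. -/
class IsStronglyTopologicalGyrogroup (G : Type u) [TopologicalSpace G] [Gyrogroup G] : Prop
    extends IsTopologicalGyrogroup G where
  exists_gyr_invariant_basis : ∃ 𝓤 : Set (Set G), (𝓝 (0 : G)).HasBasis (fun U => U ∈ 𝓤) id ∧
    ∀ U ∈ 𝓤, ∀ x y : G, (fun z => Gyrogroup.gyr x y z) '' U = U

/-- A space is submaximal if each of its dense subsets is open. -/
def IsSubmaximal (X : Type u) [TopologicalSpace X] : Prop :=
  ∀ s : Set X, Dense s → IsOpen s

/-- A space is hereditarily paracompact if every subspace is paracompact (paracompact spaces being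
Hausdorff by convention). -/
def IsHereditarilyParacompact (X : Type u) [TopologicalSpace X] : Prop :=
  ∀ s : Set X, T2Space s ∧ ParacompactSpace s

/-- A functionally open set (cozero set). -/
def IsFunctionallyOpen {X : Type u} [TopologicalSpace X] (U : Set X) : Prop :=
  ∃ f : X → ℝ, Continuous f ∧ U = {x | f x ≠ 0}

/-- `𝓤` is a finite cover of `X` by functionally open sets. -/
def IsFiniteFunctionallyOpenCover {X : Type u} [TopologicalSpace X] (𝓤 : Set (Set X)) : Prop :=
  𝓤.Finite ∧ (∀ U ∈ 𝓤, IsFunctionallyOpen U) ∧ ⋃₀ 𝓤 = univ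

/-- `dim X ≤ n`: every finite functionally open cover of `X` has a finite functionally open
refinement of order at most `n`, that is, any `n + 2` distinct members of it have empty
intersection. -/
def CoveringDimLE (X : Type u) [TopologicalSpace X] (n : ℕ) : Prop :=
  ∀ 𝓤 : Set (Set X), IsFiniteFunctionallyOpenCover 𝓤 →
    ∃ 𝓥 : Set (Set X), IsFiniteFunctionallyOpenCover 𝓥 ∧ (∀ V ∈ 𝓥, ∃ U ∈ 𝓤, V ⊆ U) ∧
      ∀ 𝓢 ⊆ 𝓥, 𝓢.ncard = n + 2 → ⋂₀ 𝓢 = ∅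

open Classical in
/-- The covering (Čech–Lebesgue) dimension `dim X`: it is `⊥` (that is, `-1`) for the empty space,
and otherwise the least `n` with `dim X ≤ n`, or `⊤` if there is none. -/
noncomputable def coveringDim (X : Type u) [TopologicalSpace X] : WithBot ℕ∞ :=
  if IsEmpty X then ⊥ else ⨅ (n : ℕ) (_ : CoveringDimLE X n), ((n : ℕ∞) : WithBot ℕ∞)

/-! The core is `hasUniformlyDiscreteColoring_univ`: `G` splits into countably many colour classes,
each uniformly discrete for an entourage given by a gyr-invariant neighbourhood of `0`. Balls around
the points of one class then form a locally finite disjoint family. In a regular space such a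
decomposition yields a clopen base and a disjoint open refinement of every open cover, hence
paracompactness and dimension zero; it passes to subspaces.

Associativity is replaced by the permutation group generated by left translations. It preserves the
entourages, because `-(a + x) + (a + y) = gyr a x (-x + y)`, and it acts by homeomorphisms.

If `0` is not isolated, take a nonempty open `W` of least cardinality, and let `Γ` be generated by
the translations by elements of `W`. The orbit `Γ 0` is open, and translating it reduces the problem
to colouring it (`HasUniformlyDiscreteColoring.of_orbit`). If `W` is countable, so is the orbit.
Otherwise well-order `W` in its initial ordinal. The initial segments generate an increasing chain
of subgroups whose orbits of `0` are smaller than `W`, so have empty interior. The rank of a point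
is the stage at which it enters. Submaximality and translation show that rank maps the punctured
neighbourhoods of `0` to a free ultrafilter. Without measurable cardinals, some `r` into `ℕ` tends
to infinity along it (`exists_nat_map_tendsto_of_rank`). Colour a point by the list of `r`-values
met while descending through the chain: two points of one colour can be moved to `0` and some `z ≠
0` with `r (rank z)` in that list (`exists_chain_coloring`), so `z` cannot be too near `0`. -/

/-! ### Regular σ-discretely expandable spaces -/

/-- A space is a countable union of sets `E n` whose points expand to a locally finite disjoint
family of open sets. -/
def SigmaDiscretelyExpandable (Y : Type u) [TopologicalSpace Y] : Prop :=
  ∃ (E : ℕ → Set Y) (O : ℕ → Y → Set Y), (⋃ n, E n = univ) ∧ (∀ n y, IsOpen (O n y)) ∧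
    (∀ n, ∀ y ∈ E n, y ∈ O n y) ∧ (∀ n, LocallyFinite fun y : E n => O n y) ∧
    ∀ n, (E n).PairwiseDisjoint (O n)

theorem SigmaDiscretelyExpandable.subtype {Y : Type u} [TopologicalSpace Y]
    (h : SigmaDiscretelyExpandable Y) (s : Set Y) : SigmaDiscretelyExpandable s := by
  obtain ⟨E, O, hE, hO, hm, hl, hd⟩ := h
  refine ⟨fun n => Subtype.val ⁻¹' E n, fun n y => Subtype.val ⁻¹' O n y, ?_, ?_, ?_, ?_, ?_⟩
  · rw [← preimage_iUnion, hE, preimage_univ]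
  · exact fun n y => (hO n y).preimage continuous_subtype_val
  · exact fun n y hy => hm n y hy
  · intro n
    have h1 := (hl n).preimage_continuous (continuous_subtype_val (p := (· ∈ s)))
    refine h1.comp_injective (g := fun y : (Subtype.val ⁻¹' E n : Set s) => (⟨y.1.1, y.2⟩ : E n)) ?_
    intro a b hab
    exact Subtype.ext (Subtype.ext (congrArg (fun z : E n => z.1) hab))
  · intro n y hy z hz hyz
    exact (hd n hy hz fun h => hyz (Subtype.ext h)).preimage _

section Expand

variable {Y : Type u} [TopologicalSpace Y] [RegularSpace Y] {E : Set Y} {O : Y → Set Y}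

/-- Enlarging one of two open sets with disjoint closures by a discretely expandable set. -/
theorem exists_open_superset_disjoint_closure (hO : ∀ y, IsOpen (O y)) (hm : ∀ y ∈ E, y ∈ O y)
    (hl : LocallyFinite fun y : E => O y) {P Q A : Set Y} (hP : IsOpen P)
    (hPQ : Disjoint (closure P) (closure Q)) (hA : A ⊆ E) (hAQ : Disjoint A (closure Q)) :
    ∃ P', P ⊆ P' ∧ A ⊆ P' ∧ IsOpen P' ∧ Disjoint (closure P') (closure Q) := by
  have key : ∀ y : E, ∃ N, IsOpen N ∧ N ⊆ O y ∧ (y.1 ∈ A → y.1 ∈ N) ∧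
      Disjoint (closure N) (closure Q) := by
    intro y
    by_cases hy : y.1 ∈ A
    · have h1 : O y ∩ (closure Q)ᶜ ∈ 𝓝 y.1 := Filter.inter_mem ((hO y).mem_nhds (hm y y.2))
        (isClosed_closure.isOpen_compl.mem_nhds (disjoint_left.1 hAQ hy))
      obtain ⟨t, ht, htc, hts⟩ := exists_mem_nhds_isClosed_subset h1
      refine ⟨interior t, isOpen_interior, fun z hz => (hts (interior_subset hz)).1,
        fun _ => mem_interior_iff_mem_nhds.2 ht, ?_⟩
      refine disjoint_left.2 fun z hz => (hts ?_).2
      exact closure_minimal interior_subset htc hz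
    · exact ⟨∅, isOpen_empty, empty_subset _, fun h => (hy h).elim, by simp⟩
  choose N hN hNO hNA hNQ using key
  have hNl : LocallyFinite N := hl.subset hNO
  -- Local finiteness makes the closure of the union the union of the closures.
  refine ⟨P ∪ ⋃ y, N y, subset_union_left, fun y hy => Or.inr (mem_iUnion.2 ⟨⟨y, hA hy⟩, hNA _ hy⟩),
    hP.union (isOpen_iUnion hN), ?_⟩
  rw [closure_union, hNl.closure_iUnion, disjoint_union_left, disjoint_iUnion_left]
  exact ⟨hPQ, hNQ⟩

/-- Points of `E` off `closure Q` go to `P'`; the others lie in `closure Q`, hence off `closure P'`,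
and go to `Q'`. -/
theorem exists_open_supersets_cover (hO : ∀ y, IsOpen (O y)) (hm : ∀ y ∈ E, y ∈ O y)
    (hl : LocallyFinite fun y : E => O y) {P Q : Set Y} (hP : IsOpen P) (hQ : IsOpen Q)
    (hPQ : Disjoint (closure P) (closure Q)) :
    ∃ P' Q', P ⊆ P' ∧ Q ⊆ Q' ∧ IsOpen P' ∧ IsOpen Q' ∧ Disjoint (closure P') (closure Q') ∧
      E ⊆ P' ∪ Q' := by
  obtain ⟨P', h1, h2, h3, h4⟩ := exists_open_superset_disjoint_closure hO hm hl hP hPQ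
    (A := E \ closure Q) sdiff_subset disjoint_sdiff_left
  obtain ⟨Q', k1, k2, k3, k4⟩ := exists_open_superset_disjoint_closure hO hm hl hQ h4.symm
    (A := E ∩ closure Q) inter_subset_left (h4.symm.mono_left inter_subset_right)
  refine ⟨P', Q', h1, k1, h3, k3, k4.symm, fun y hy => ?_⟩
  by_cases hyQ : y ∈ closure Q
  · exact Or.inr (k2 ⟨hy, hyQ⟩)
  · exact Or.inl (h2 ⟨hy, hyQ⟩)

/-- As in Urysohn's lemma, start from a neighbourhood of `x` and the complement of a larger one, and
enlarge both alternately. Stage `n` absorbs `E n`, so the two limit unions are open, disjoint and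
cover `Y`. -/
theorem SigmaDiscretelyExpandable.exists_isClopen_subset (h : SigmaDiscretelyExpandable Y)
    {x : Y} {U : Set Y} (hU : U ∈ 𝓝 x) : ∃ C, IsClopen C ∧ x ∈ C ∧ C ⊆ U := by
  obtain ⟨E, O, hE, hO, hm, hl, -⟩ := h
  obtain ⟨F, hF, hFc, hFU⟩ := exists_mem_nhds_isClosed_subset hU
  obtain ⟨F', hF', hFc', hFF'⟩ := exists_mem_nhds_isClosed_subset (interior_mem_nhds.2 hF)
  let S := {PQ : Set Y × Set Y // IsOpen PQ.1 ∧ IsOpen PQ.2 ∧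
    Disjoint (closure PQ.1) (closure PQ.2)}
  have step : ∀ (n : ℕ) (s : S), ∃ t : S, s.1.1 ⊆ t.1.1 ∧ s.1.2 ⊆ t.1.2 ∧
      E n ⊆ t.1.1 ∪ t.1.2 := by
    rintro n ⟨⟨P, Q⟩, hP, hQ, hPQ⟩
    obtain ⟨P', Q', h1, h2, h3, h4, h5, h6⟩ :=
      exists_open_supersets_cover (hO n) (hm n) (hl n) hP hQ hPQ
    exact ⟨⟨(P', Q'), h3, h4, h5⟩, h1, h2, h6⟩
  choose f hf1 hf2 hf3 using step
  have h0 : Disjoint (closure (interior F')) (closure Fᶜ) := by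
    rw [closure_compl]
    refine disjoint_left.2 fun z hz hz' => hz' (hFF' ?_)
    exact closure_minimal interior_subset hFc' hz
  let s0 : S := ⟨(interior F', Fᶜ), isOpen_interior, hFc.isOpen_compl, h0⟩
  let s : ℕ → S := fun n => Nat.rec s0 f n
  have hs : ∀ n, s (n + 1) = f n (s n) := fun n => rfl
  have mono1 : Monotone fun n => (s n).1.1 := monotone_nat_of_le_succ fun n => hf1 n (s n)
  have mono2 : Monotone fun n => (s n).1.2 := monotone_nat_of_le_succ fun n => hf2 n (s n)
  have hdisj : ∀ z, z ∈ ⋃ n, (s n).1.1 → z ∉ ⋃ n, (s n).1.2 := by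
    intro z h1 h2
    obtain ⟨m, h1⟩ := mem_iUnion.1 h1
    obtain ⟨n, h2⟩ := mem_iUnion.1 h2
    have h1' := mono1 (le_max_left m n) h1
    have h2' := mono2 (le_max_right m n) h2
    exact disjoint_left.1 (s (max m n)).2.2.2 (subset_closure h1') (subset_closure h2')
  have hcov : ∀ z, z ∉ ⋃ n, (s n).1.2 → z ∈ ⋃ n, (s n).1.1 := by
    intro z hz
    obtain ⟨n, hn⟩ := mem_iUnion.1 (hE.symm ▸ mem_univ z : z ∈ ⋃ n, E n)
    rcases hf3 n (s n) hn with h | h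
    · exact mem_iUnion.2 ⟨n + 1, h⟩
    · exact (hz (mem_iUnion.2 ⟨n + 1, h⟩)).elim
  have hcompl : (⋃ n, (s n).1.1)ᶜ = ⋃ n, (s n).1.2 := by
    ext z
    exact ⟨fun h => by_contra fun h' => h (hcov z h'), fun h h' => hdisj z h' h⟩
  refine ⟨⋃ n, (s n).1.1, ⟨⟨?_⟩, isOpen_iUnion fun n => (s n).2.1⟩, ?_, ?_⟩
  · rw [hcompl]
    exact isOpen_iUnion fun n => (s n).2.2.1
  · exact mem_iUnion.2 ⟨0, mem_interior_iff_mem_nhds.2 hF'⟩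
  · intro z hz
    by_contra hzU
    exact hdisj z hz (mem_iUnion.2 ⟨0, fun hzF => hzU (hFU hzF)⟩)

/-- Every open cover of a regular σ-discretely expandable space has a disjoint open refinement. -/
theorem SigmaDiscretelyExpandable.exists_isLocallyConstant_selection
    (h : SigmaDiscretelyExpandable Y) {ι : Type*} {U : ι → Set Y} (hU : ∀ i, IsOpen (U i))
    (hcov : ⋃ i, U i = univ) : ∃ g : Y → ι, IsLocallyConstant g ∧ ∀ y, y ∈ U (g y) := by
  have hclopen := fun (x : Y) (V : Set Y) (hV : V ∈ 𝓝 x) => h.exists_isClopen_subset hV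
  obtain ⟨E, O, hE, hO, hm, hl, hd⟩ := h
  have hi : ∀ y, ∃ i, y ∈ U i := fun y => mem_iUnion.1 (hcov.symm ▸ mem_univ y)
  choose i hi using hi
  have hC : ∀ (n : ℕ) (y : E n), ∃ C, IsClopen C ∧ y.1 ∈ C ∧ C ⊆ O n y ∩ U (i y) := fun n y =>
    hclopen y _ (Filter.inter_mem ((hO n y).mem_nhds (hm n y y.2)) ((hU _).mem_nhds (hi y)))
  choose C hCc hCm hCs using hC
  have hK : ∀ n, IsClosed (⋃ y, C n y) := fun n =>
    ((hl n).subset fun y z hz => (hCs n y hz).1).isClosed_iUnion fun y => (hCc n y).1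
  have hx : ∀ x, ∃ n, x ∈ ⋃ y, C n y := by
    intro x
    obtain ⟨n, hn⟩ := mem_iUnion.1 (hE.symm ▸ mem_univ x : x ∈ ⋃ n, E n)
    exact ⟨n, mem_iUnion.2 ⟨⟨x, hn⟩, hCm n ⟨x, hn⟩⟩⟩
  classical
  -- The first level covering `x`. Each level is a closed union of disjoint clopen sets, so `ν` and
  -- the member containing `x` are locally constant.
  let ν : Y → ℕ := fun x => Nat.find (hx x)
  have hν : ∀ x, ∃ y, x ∈ C (ν x) y := fun x => mem_iUnion.1 (Nat.find_spec (hx x))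
  choose π hπ using hν
  have huniq : ∀ n (y z : E n) x, x ∈ C n y → x ∈ C n z → y = z := by
    intro n y z x hy hz
    by_contra hne
    exact disjoint_left.1 (hd n y.2 z.2 fun h => hne (Subtype.ext h)) (hCs n y hy).1
      (hCs n z hz).1
  refine ⟨fun x => i (π x).1, ?_, fun x => (hCs _ _ (hπ x)).2⟩
  rw [IsLocallyConstant.iff_eventually_eq]
  intro x
  have h1 : C (ν x) (π x) ∈ 𝓝 x := (hCc _ _).2.mem_nhds (hπ x)
  have h2 : ⋂ m ∈ Finset.range (ν x), (⋃ y, C m y)ᶜ ∈ 𝓝 x := by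
    refine (Filter.biInter_finset_mem _).2 fun m hm => (hK m).isOpen_compl.mem_nhds ?_
    exact Nat.find_min (hx x) (Finset.mem_range.1 hm)
  filter_upwards [h1, h2] with z hz1 hz2
  have hzν : ν z = ν x := by
    refine (Nat.find_eq_iff (hx z)).2 ⟨mem_iUnion.2 ⟨_, hz1⟩, fun m hm => ?_⟩
    exact mem_iInter₂.1 hz2 m (Finset.mem_range.2 hm)
  -- `π z` lives in `E (ν z)`, so the level is generalised before it is compared with `π x`.
  have key : ∀ n (hn : n = ν x) (p : E n), z ∈ C n p → p.1 = (π x).1 := by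
    rintro n rfl p hp
    rw [huniq _ _ _ z hp hz1]
  rw [key _ hzν _ (hπ z)]

theorem SigmaDiscretelyExpandable.paracompactSpace (h : SigmaDiscretelyExpandable Y) :
    ParacompactSpace Y := by
  refine ⟨fun α s hs hc => ?_⟩
  obtain ⟨g, hg, hgs⟩ := h.exists_isLocallyConstant_selection hs hc
  refine ⟨α, fun a => g ⁻¹' {a}, fun a => hg _, ?_, fun x => ?_, fun a => ⟨a, ?_⟩⟩
  · exact eq_univ_of_forall fun y => mem_iUnion.2 ⟨g y, rfl⟩
  · refine ⟨g ⁻¹' {g x}, (hg _).mem_nhds rfl, (finite_singleton (g x)).subset ?_⟩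
    rintro a ⟨z, hz1, hz2⟩
    exact (mem_singleton_iff.1 hz1).symm.trans hz2
  · rintro y rfl
    exact hgs y

theorem SigmaDiscretelyExpandable.coveringDimLE_zero (h : SigmaDiscretelyExpandable Y) :
    CoveringDimLE Y 0 := by
  rintro 𝓤 ⟨hfin, hopen, hcov⟩
  obtain ⟨g, hg, hgs⟩ := h.exists_isLocallyConstant_selection (U := fun U : 𝓤 => U.1)
    (fun U => by
      obtain ⟨f, hf, hU⟩ := hopen U U.2
      rw [hU]
      exact isOpen_ne_fun hf continuous_const) (by rw [← sUnion_eq_iUnion, hcov])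
  have : Finite 𝓤 := hfin
  refine ⟨range fun U : 𝓤 => g ⁻¹' {U}, ⟨finite_range _, ?_, ?_⟩, ?_, ?_⟩
  · rintro _ ⟨U, rfl⟩
    have hcl : IsClopen (g ⁻¹' {U}) := hg.isClopen_fiber U
    classical
    refine ⟨(g ⁻¹' {U}).indicator 1, ?_, ?_⟩
    · exact continuous_one.indicator fun a ha => by simp [hcl.frontier_eq] at ha
    · ext z
      simp [indicator_apply]
  · rw [sUnion_range]
    exact eq_univ_of_forall fun y => mem_iUnion.2 ⟨g y, rfl⟩
  · rintro _ ⟨U, rfl⟩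
    exact ⟨U, U.2, by rintro y rfl; exact hgs y⟩
  · intro 𝓢 h𝓢 hcard
    obtain ⟨A, B, hAB, rfl⟩ := ncard_eq_two.1 hcard
    obtain ⟨U, rfl⟩ := h𝓢 (mem_insert A _)
    obtain ⟨V, rfl⟩ := h𝓢 (mem_insert_of_mem _ (mem_singleton B))
    refine eq_empty_of_forall_notMem fun z hz => hAB ?_
    rw [sInter_pair] at hz
    have h1 : g z = U := hz.1
    have h2 : g z = V := hz.2
    dsimp only
    rw [← h1, ← h2]

end Expand

theorem coveringDim_eq_zero {X : Type u} [TopologicalSpace X] [Nonempty X]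
    (h : CoveringDimLE X 0) : coveringDim X = 0 := by
  rw [coveringDim, if_neg (not_isEmpty_of_nonempty X)]
  refine le_antisymm (iInf₂_le 0 h) (le_iInf₂ fun n _ => ?_)
  exact_mod_cast bot_le

theorem perm_apply_inv {α : Type*} (g : Equiv.Perm α) (x : α) : g (g⁻¹ x) = x :=
  g.apply_symm_apply x

theorem perm_inv_apply {α : Type*} (g : Equiv.Perm α) (x : α) : g⁻¹ (g x) = x :=
  g.symm_apply_apply x

/-! ### Colouring an orbit along a chain of permutation groups -/

section Chain

variable {α ι : Type*} [LinearOrder ι] [WellFoundedLT ι]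

/-- Every point of the orbit of `o` other than `o` enters the chain at some stage. -/
theorem exists_chain_stage {o : α} {Gle Glt : ι → Subgroup (Equiv.Perm α)}
    (hlt : ∀ a, ∀ g ∈ Glt a, g o = o ∨ ∃ b < a, ∃ k ∈ Gle b, k o = g o) {x : α}
    (hx : ∃ a, ∃ g ∈ Gle a, g o = x) (hxo : x ≠ o) :
    ∃ a, (∃ g ∈ Gle a, g o = x) ∧ ¬ ∃ g ∈ Glt a, g o = x := by
  refine ⟨wellFounded_lt.min {a | ∃ g ∈ Gle a, g o = x} hx, wellFounded_lt.min_mem _ hx, ?_⟩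
  rintro ⟨g, hg, hgx⟩
  rcases hlt _ g hg with h | ⟨b, hb, k, hk, hkg⟩
  · exact hxo (hgx.symm.trans h)
  · exact wellFounded_lt.not_lt_min {a | ∃ g ∈ Gle a, g o = x} (x := b) ⟨k, hk, hkg.trans hgx⟩ hb

/-- Colouring of the orbit of `o` under an increasing chain of permutation groups: two points of
the same colour can be moved so that one of them becomes `o` and the other one gets a rank whose
`r`-value occurs in the colour. -/
theorem exists_chain_coloring (o : α) (Gle Glt : ι → Subgroup (Equiv.Perm α))
    (Γ : Subgroup (Equiv.Perm α)) (hΓ : ∀ a, Gle a ≤ Γ)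
    (hlt_le : ∀ a, Glt a ≤ Gle a) (hle_lt : ∀ a b, a < b → Gle a ≤ Glt b)
    (hlt : ∀ a, ∀ g ∈ Glt a, g o = o ∨ ∃ b < a, ∃ k ∈ Gle b, k o = g o) (r : ι → ℕ)
    (rank : α → ι)
    (hrank : ∀ a x, (∃ g ∈ Gle a, g o = x) → (¬ ∃ g ∈ Glt a, g o = x) → rank x = a) :
    ∃ color : α → List ℕ, ∀ x y, (∃ a, ∃ g ∈ Gle a, g o = x) → (∃ a, ∃ g ∈ Gle a, g o = y) →
      x ≠ y → color x = color y → ∃ g ∈ Γ, ∃ z, z ≠ o ∧ r (rank z) ∈ color x ∧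
        ((g o = x ∧ g z = y) ∨ (g o = y ∧ g z = x)) := by
  classical
  let X : Set α := {x | ∃ a, ∃ g ∈ Gle a, g o = x}
  let Lt : ι → Set α := fun a => {x | ∃ g ∈ Glt a, g o = x}
  have hoLt : ∀ a, o ∈ Lt a := fun a => ⟨1, one_mem _, rfl⟩
  have hmin : ∀ x ∈ X, x ≠ o → (∃ g ∈ Gle (rank x), g o = x) ∧ x ∉ Lt (rank x) := by
    intro x hx hxo
    obtain ⟨a, ha, ha'⟩ := exists_chain_stage hlt hx hxo
    rw [hrank a x ha ha']
    exact ⟨ha, ha'⟩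
  have hltrank : ∀ a x, x ∈ Lt a → x ≠ o → x ∈ X ∧ rank x < a := by
    rintro a x ⟨g, hg, rfl⟩ hxo
    have hX : g o ∈ X := ⟨a, g, hlt_le a hg, rfl⟩
    refine ⟨hX, ?_⟩
    rcases hlt a g hg with h | ⟨b, hb, k, hk, hkg⟩
    · exact (hxo h).elim
    · refine lt_of_le_of_lt (not_lt.1 fun hlt' => (hmin _ hX hxo).2 ?_) hb
      exact ⟨k, hle_lt _ _ hlt' hk, hkg⟩
  -- The `t` for which `x` lies in the copy `t (Lt (rank x))` of the earlier orbit. Choosing the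
  -- least one makes points of the same copy comparable.
  let S : α → Set (Equiv.Perm α) := fun x => {t | t ∈ Gle (rank x) ∧ t⁻¹ x ∈ Lt (rank x)}
  have hwf : WellFounded (WellOrderingRel (α := Equiv.Perm α)) := WellOrderingRel.isWellOrder.wf
  have hS : ∀ x ∈ X, x ≠ o → (S x).Nonempty := by
    intro x hx hxo
    obtain ⟨⟨g, hg, hgx⟩, -⟩ := hmin x hx hxo
    refine ⟨g, hg, ?_⟩
    rw [← hgx, perm_inv_apply]
    exact hoLt _
  let T : α → Equiv.Perm α := fun x => if h : (S x).Nonempty then hwf.min (S x) h else 1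
  have hT : ∀ x ∈ X, x ≠ o → T x ∈ S x ∧ ∀ t ∈ S x, ¬ WellOrderingRel t (T x) := by
    intro x hx hxo
    have hT' : T x = hwf.min (S x) (hS x hx hxo) := dif_pos _
    rw [hT']
    exact ⟨hwf.min_mem _ _, fun t ht => hwf.not_lt_min _ ht⟩
  -- `o` lies in every `Lt a`, so its `rank` carries no information; it is put at the bottom to make
  -- each descent strict.
  let rk : α → WithBot ι := fun x => if x = o then ⊥ else rank x
  have hrkwf : WellFounded fun x y => rk x < rk y := InvImage.wf rk wellFounded_lt
  let color : α → List ℕ := hrkwf.fix fun x rec =>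
    if h : x ≠ o ∧ rk ((T x)⁻¹ x) < rk x then r (rank x) :: rec _ h.2 else []
  have hcolor_o : color o = [] := by
    change hrkwf.fix _ o = _
    rw [WellFounded.fix_eq, dif_neg (fun h => h.1 rfl)]
  have hstep : ∀ x ∈ X, x ≠ o → rk ((T x)⁻¹ x) < rk x := by
    intro x hx hxo
    have h1 := (hT x hx hxo).1.2
    by_cases h : (T x)⁻¹ x = o
    · simp only [rk, h, hxo, if_true, if_false]
      exact WithBot.bot_lt_coe _
    · simp only [rk, h, hxo, if_false]
      exact WithBot.coe_lt_coe.2 (hltrank _ _ h1 h).2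
  have hcolor : ∀ x ∈ X, x ≠ o → color x = r (rank x) :: color ((T x)⁻¹ x) := by
    intro x hx hxo
    change hrkwf.fix _ x = _
    rw [WellFounded.fix_eq, dif_pos ⟨hxo, hstep x hx hxo⟩]
  have hstepX : ∀ x ∈ X, x ≠ o → (T x)⁻¹ x ∈ X := by
    intro x hx hxo
    obtain ⟨k, hk, hkx⟩ := (hT x hx hxo).1.2
    exact ⟨_, k, hlt_le _ hk, hkx⟩
  have hrank_move : ∀ (a : ι) (g : Equiv.Perm α) (y : α), g ∈ Gle a → (∃ k ∈ Gle a, k o = y) →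
      g⁻¹ y ∉ Lt a → g⁻¹ y ≠ o ∧ rank (g⁻¹ y) = a := by
    rintro a g y hg ⟨k, hk, rfl⟩ hn
    exact ⟨fun h => hn (by rw [h]; exact hoLt a), hrank _ _ ⟨g⁻¹ * k, mul_mem (inv_mem hg) hk, rfl⟩ hn⟩
  -- The permutation moving `o` to the lower point belongs to `Glt (rank y)`, so its inverse
  -- preserves the rank of `y`.
  have hlow : ∀ x ∈ X, x ≠ o → ∀ y ∈ X, y ≠ o → rank x < rank y →
      ∃ g ∈ Γ, ∃ z, z ≠ o ∧ rank z = rank y ∧ g o = x ∧ g z = y := by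
    intro x hx hxo y hy hyo hxy
    obtain ⟨⟨g, hg, hgx⟩, -⟩ := hmin x hx hxo
    obtain ⟨hy1, hy2⟩ := hmin y hy hyo
    have hglt := hle_lt _ _ hxy hg
    have hn : g⁻¹ y ∉ Lt (rank y) := by
      rintro ⟨k, hk, hky⟩
      exact hy2 ⟨g * k, mul_mem hglt hk, by rw [Equiv.Perm.mul_apply, hky,
        perm_apply_inv]⟩
    obtain ⟨h1, h2⟩ := hrank_move _ g y (hlt_le _ hglt) hy1 hn
    exact ⟨g, hΓ _ hg, _, h1, h2, hgx, perm_apply_inv _ _⟩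
  have hsame : ∀ x ∈ X, x ≠ o → ∀ y ∈ X, y ≠ o → rank x = rank y →
      WellOrderingRel (T x) (T y) → ∃ g ∈ Γ, ∃ z, z ≠ o ∧ rank z = rank y ∧ g o = x ∧ g z = y := by
    intro x hx hxo y hy hyo hxy hTT
    obtain ⟨hTx, k, hk, hkx⟩ := (hT x hx hxo).1
    have hy1 := (hmin y hy hyo).1
    rw [hxy] at hTx hk
    -- Otherwise `y` would lie in the copy given by `T x`, against the minimality of `T y`.
    have hn : (T x * k)⁻¹ y ∉ Lt (rank y) := by
      rintro ⟨l, hl, hly⟩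
      refine (hT y hy hyo).2 (T x) ⟨hTx, k * l, mul_mem hk hl, ?_⟩ hTT
      rw [Equiv.Perm.mul_apply, hly, mul_inv_rev, Equiv.Perm.mul_apply,
        perm_apply_inv]
    have hg := mul_mem hTx (hlt_le _ hk)
    obtain ⟨h1, h2⟩ := hrank_move _ (T x * k) y hg hy1 hn
    refine ⟨T x * k, hΓ _ hg, _, h1, h2, ?_, perm_apply_inv _ _⟩
    rw [Equiv.Perm.mul_apply, hkx, perm_apply_inv]
  refine ⟨color, fun x => ?_⟩
  induction x using hrkwf.induction with
  | _ x ih =>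
  intro y hx hy hxy hc
  by_cases hxo : x = o
  · have hyo : y ≠ o := fun h => hxy (hxo.trans h.symm)
    rw [hxo, hcolor_o, hcolor y hy hyo] at hc
    exact (List.cons_ne_nil _ _ hc.symm).elim
  by_cases hyo : y = o
  · rw [hyo, hcolor_o, hcolor x hx hxo] at hc
    exact (List.cons_ne_nil _ _ hc).elim
  have hc' := hc
  rw [hcolor x hx hxo, hcolor y hy hyo, List.cons.injEq] at hc'
  have hmemx : r (rank x) ∈ color x := by
    rw [hcolor x hx hxo]
    exact List.mem_cons_self
  have hmemy : r (rank y) ∈ color x := hc'.1 ▸ hmemx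
  rcases lt_trichotomy (rank x) (rank y) with h | h | h
  · obtain ⟨g, hg, z, hz, hzr, h1, h2⟩ := hlow x hx hxo y hy hyo h
    exact ⟨g, hg, z, hz, hzr ▸ hmemy, Or.inl ⟨h1, h2⟩⟩
  · rcases trichotomous_of (WellOrderingRel (α := Equiv.Perm α)) (T x) (T y) with
      h' | h' | h'
    · obtain ⟨g, hg, z, hz, hzr, h1, h2⟩ := hsame x hx hxo y hy hyo h h'
      exact ⟨g, hg, z, hz, hzr ▸ hmemy, Or.inl ⟨h1, h2⟩⟩
    -- Both points lie in the same copy: pull them back by the common permutation and use induction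
    -- on the tails of their colours.
    · have hne : (T x)⁻¹ x ≠ (T y)⁻¹ y := by
        rw [h']
        exact fun h'' => hxy ((T y)⁻¹.injective h'')
      obtain ⟨g, hg, z, hz, hzr, h1⟩ :=
        ih _ (hstep x hx hxo) _ (hstepX x hx hxo) (hstepX y hy hyo) hne hc'.2
      refine ⟨T x * g, mul_mem (hΓ _ (hT x hx hxo).1.1) hg, z, hz, ?_, ?_⟩
      · rw [hcolor x hx hxo]
        exact List.mem_cons_of_mem _ hzr
      · simp only [Equiv.Perm.mul_apply]
        rcases h1 with ⟨h1, h2⟩ | ⟨h1, h2⟩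
        · exact Or.inl ⟨by rw [h1, perm_apply_inv],
            by rw [h2, h', perm_apply_inv]⟩
        · exact Or.inr ⟨by rw [h1, h', perm_apply_inv],
            by rw [h2, perm_apply_inv]⟩
    · obtain ⟨g, hg, z, hz, hzr, h1, h2⟩ := hsame y hy hyo x hx hxo h.symm h'
      exact ⟨g, hg, z, hz, hzr ▸ hmemx, Or.inr ⟨h1, h2⟩⟩
  · obtain ⟨g, hg, z, hz, hzr, h1, h2⟩ := hlow y hy hyo x hx hxo h
    exact ⟨g, hg, z, hz, hzr ▸ hmemx, Or.inr ⟨h1, h2⟩⟩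

end Chain

/-! ### Free ultrafilters without measurable cardinals -/

section Measurable

variable {ι : Type u}

/-- If there are no measurable cardinals, then every free ultrafilter is countably incomplete. -/
theorem exists_iInter_eq_empty_of_no_measurable
    (hmeas : ¬ ∃ m : Cardinal.{u}, IsMeasurableCardinal m) (q : Ultrafilter ι)
    (hq : ∀ a, {a} ∉ q) : ∃ S : ℕ → Set ι, (∀ n, S n ∈ q) ∧ ⋂ n, S n = ∅ := by
  classical
  by_contra! hcon
  -- Adding the complement of the intersection to each set upgrades nonempty countable intersections
  -- to membership in `q`; then `q` defines a 0-1 measure.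
  have hcon' : ∀ S : ℕ → Set ι, (∀ n, S n ∈ q) → ⋂ n, S n ∈ q := by
    intro S hS
    by_contra hnot
    obtain ⟨a, ha⟩ := hcon (fun n => S n ∩ (⋂ n, S n)ᶜ)
      fun n => Filter.inter_mem (hS n) (Ultrafilter.compl_mem_iff_notMem.2 hnot)
    exact (mem_iInter.1 ha 0).2 (mem_iInter.2 fun n => (mem_iInter.1 ha n).1)
  have hU : ∀ f : ℕ → Set ι, (⋃ n, f n) ∈ q → ∃ n, f n ∈ q := by
    intro f hf
    by_contra! h
    have h1 := hcon' (fun n => (f n)ᶜ) fun n => Ultrafilter.compl_mem_iff_notMem.2 (h n)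
    rw [← compl_iUnion] at h1
    exact Ultrafilter.compl_mem_iff_notMem.1 h1 hf
  let μ : @Measure ι ⊤ := @Measure.ofMeasurable ι ⊤ (fun s _ => if s ∈ q then 1 else 0)
    (if_neg q.empty_notMem) (by
      intro f _ hd
      by_cases h : (⋃ n, f n) ∈ q
      · obtain ⟨n, hn⟩ := hU f h
        rw [if_pos h, tsum_eq_single n, if_pos hn]
        intro m hm
        refine if_neg fun hm' => q.empty_notMem ?_
        have := Filter.inter_mem hm' hn
        rwa [(hd hm).inter_eq] at this
      · rw [if_neg h]
        refine (ENNReal.tsum_eq_zero.2 fun n => if_neg fun hn => h ?_).symm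
        exact Filter.mem_of_superset hn (subset_iUnion f n))
  have hμ : ∀ s : Set ι, μ s = if s ∈ q then 1 else 0 := fun s =>
    @Measure.ofMeasurable_apply ι ⊤ _ _ _ s trivial
  have hnm : IsNonmeasurableCardinal (Cardinal.mk ι) := by
    by_contra h
    exact hmeas ⟨_, h⟩
  have h0 := hnm ι rfl μ (fun s => by rw [hμ]; by_cases h : s ∈ q <;> simp [h])
    fun a => by rw [hμ, if_neg (hq a)]
  have h1 : μ univ = 1 := (hμ univ).trans (if_pos (Filter.univ_mem (f := (q : Filter ι))))
  rw [h0, Measure.coe_zero, Pi.zero_apply] at h1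
  exact zero_ne_one h1

theorem exists_nat_map_of_no_measurable
    (hmeas : ¬ ∃ m : Cardinal.{u}, IsMeasurableCardinal m) (q : Ultrafilter ι)
    (hq : ∀ a, {a} ∉ q) : ∃ r : ι → ℕ, ∀ n, {a | n < r a} ∈ q := by
  classical
  obtain ⟨S, hS, hS'⟩ := exists_iInter_eq_empty_of_no_measurable hmeas q hq
  have h : ∀ a, ∃ n, a ∉ S n := by
    intro a
    by_contra! h
    exact (hS' ▸ mem_iInter.2 h : a ∈ (∅ : Set ι))
  refine ⟨fun a => Nat.find (h a), fun n => ?_⟩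
  have h1 : ⋂ k ∈ Finset.range (n + 1), S k ∈ q :=
    (Filter.biInter_finset_mem _).2 fun k _ => hS k
  refine Filter.mem_of_superset h1 fun a ha => ?_
  refine (Nat.lt_find_iff (h a) n).2 fun m hm => not_not.2 ?_
  exact mem_iInter₂.1 ha m (Finset.mem_range.2 (Nat.lt_succ_of_le hm))

end Measurable

/-! ### Gyrogroup identities and left-invariant entourages -/

section Algebra

variable {G : Type u} [Gyrogroup G]

open Gyrogroup

theorem gyr_neg_apply (a b : G) : -a + (a + b) = gyr (-a) a b := by
  rw [add_add_gyr, Gyrogroup.neg_add_self, zero_add]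

theorem gyro_add_left_cancel {a b c : G} (h : a + b = a + c) : b = c := by
  have h1 := congrArg (-a + ·) h
  simp only [gyr_neg_apply] at h1
  exact (gyr (-a) a).injective h1

theorem gyr_zero_left (x z : G) : gyr 0 x z = z := by
  have h := add_add_gyr 0 x z
  rw [zero_add, zero_add] at h
  exact (gyro_add_left_cancel h).symm

/-- The loop property turns `gyr (-a) a` into `gyr 0 a`, which is the identity. -/
theorem gyro_neg_add_cancel_left (a b : G) : -a + (a + b) = b := by
  rw [gyr_neg_apply, ← gyr_add_left, Gyrogroup.neg_add_self, gyr_zero_left]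

theorem gyro_add_neg_cancel_left (a b : G) : a + (-a + b) = b :=
  gyro_add_left_cancel (a := -a) (gyro_neg_add_cancel_left a _)

theorem gyro_neg_zero : -(0 : G) = 0 :=
  (neg_unique 0 0 (zero_add 0) (zero_add 0)).symm

theorem gyro_neg_add_add (a x y : G) : -(a + x) + (a + y) = gyr a x (-x + y) := by
  conv_lhs => rw [← gyro_add_neg_cancel_left x y, add_add_gyr a x]
  exact gyro_neg_add_cancel_left _ _

theorem eq_of_gyro_neg_add_eq_zero {x y : G} (h : -x + y = 0) : x = y := by
  rw [← gyro_add_neg_cancel_left x y, h, add_zero]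

/-- Left translation as a permutation. -/
def leftTranslation (a : G) : Equiv.Perm G where
  toFun x := a + x
  invFun x := -a + x
  left_inv := gyro_neg_add_cancel_left a
  right_inv := gyro_add_neg_cancel_left a

/-- The group generated by all left translations. -/
def translationGroup (G : Type u) [Gyrogroup G] : Subgroup (Equiv.Perm G) :=
  Subgroup.closure (range leftTranslation)

/-- Invariance of a set under all gyrations. -/
def IsGyrInvariant (U : Set G) : Prop := ∀ a b z : G, gyr a b z ∈ U ↔ z ∈ U

/-- The symmetric left-invariant relation determined by a set `U`. -/
def Entourage (U : Set G) (x y : G) : Prop := -x + y ∈ U ∧ -y + x ∈ U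

theorem Entourage.symm {U : Set G} {x y : G} (h : Entourage U x y) : Entourage U y x :=
  And.symm h

theorem Entourage.mono {U V : Set G} (hUV : U ⊆ V) {x y : G} (h : Entourage U x y) :
    Entourage V x y := ⟨hUV h.1, hUV h.2⟩

theorem entourage_refl {U : Set G} (hU : (0 : G) ∈ U) (x : G) : Entourage U x x := by
  simpa [Entourage, Gyrogroup.neg_add_self] using hU

theorem Entourage.mem {U : Set G} {z : G} (h : Entourage U 0 z) : z ∈ U := by
  have := h.1
  rwa [gyro_neg_zero, zero_add] at this

theorem entourage_translate {U : Set G} (hU : IsGyrInvariant U) {g : Equiv.Perm G}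
    (hg : g ∈ translationGroup G) : ∀ x y, Entourage U (g x) (g y) ↔ Entourage U x y := by
  induction hg using Subgroup.closure_induction with
  | mem g hg =>
    obtain ⟨a, rfl⟩ := hg
    intro x y
    simp only [Entourage, leftTranslation, Equiv.coe_fn_mk, gyro_neg_add_add]
    rw [hU, hU]
  | one => exact fun x y => Iff.rfl
  | mul g h _ _ ihg ihh => exact fun x y => (ihg _ _).trans (ihh _ _)
  | inv g _ ih =>
    intro x y
    rw [← ih, perm_apply_inv, perm_apply_inv]

/-- Write `-x + z` as `(-x + y) + (-(-x + y) + (-x + z))`; the second summand is a gyration of `-y +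
z`. -/
theorem gyro_neg_add_trans {U V : Set G} (hV : IsGyrInvariant V)
    (hVU : ∀ v ∈ V, ∀ w ∈ V, v + w ∈ U) {x y z : G} (h1 : -x + y ∈ V) (h2 : -y + z ∈ V) :
    -x + z ∈ U := by
  have h3 : -(-x + y) + (-x + z) ∈ V := by rwa [gyro_neg_add_add, hV]
  have h4 := hVU _ h1 _ h3
  rwa [gyro_add_neg_cancel_left] at h4

end Algebra

/-! ### Uniform structure and uniformly discrete colourings -/

section Topological

variable {G : Type u} [TopologicalSpace G] [Gyrogroup G]

/-- A gyr-invariant neighbourhood of zero. -/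
def IsInvariantNhd (U : Set G) : Prop := U ∈ 𝓝 (0 : G) ∧ IsGyrInvariant U

theorem IsInvariantNhd.inter {U V : Set G} (hU : IsInvariantNhd U) (hV : IsInvariantNhd V) :
    IsInvariantNhd (U ∩ V) :=
  ⟨Filter.inter_mem hU.1 hV.1, fun a b z => and_congr (hU.2 a b z) (hV.2 a b z)⟩

variable [IsStronglyTopologicalGyrogroup G]

theorem exists_isInvariantNhd_subset {N : Set G} (hN : N ∈ 𝓝 (0 : G)) :
    ∃ U, IsInvariantNhd U ∧ U ⊆ N := by
  obtain ⟨𝓤, h𝓤, hinv⟩ := IsStronglyTopologicalGyrogroup.exists_gyr_invariant_basis (G := G)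
  obtain ⟨U, hU, hUN⟩ := h𝓤.mem_iff.1 hN
  refine ⟨U, ⟨h𝓤.mem_of_mem hU, fun a b z => ?_⟩, hUN⟩
  have h := hinv U hU a b
  refine ⟨fun hz => ?_, fun hz => h ▸ mem_image_of_mem _ hz⟩
  rw [← h] at hz
  obtain ⟨w, hw, hwz⟩ := hz
  exact (Gyrogroup.gyr a b).injective hwz ▸ hw

theorem exists_entourage_trans {U : Set G} (hU : IsInvariantNhd U) : ∃ V, IsInvariantNhd V ∧
    ∀ x y z, Entourage V x y → Entourage V y z → Entourage U x z := by
  have h : Filter.Tendsto (fun p : G × G => p.1 + p.2) (𝓝 0 ×ˢ 𝓝 0) (𝓝 0) := by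
    rw [← nhds_prod_eq]
    have := (continuous_add (M := G)).tendsto (0, 0)
    simpa using this
  obtain ⟨N, hN, hNU⟩ := Filter.mem_prod_same_iff.1 (h hU.1)
  obtain ⟨V, hV, hVN⟩ := exists_isInvariantNhd_subset hN
  have hVU : ∀ v ∈ V, ∀ w ∈ V, v + w ∈ U := fun v hv w hw => hNU (mk_mem_prod (hVN hv) (hVN hw))
  exact ⟨V, hV, fun x y z h1 h2 =>
    ⟨gyro_neg_add_trans hV.2 hVU h1.1 h2.1, gyro_neg_add_trans hV.2 hVU h2.2 h1.2⟩⟩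

theorem entourage_mem_nhds {U : Set G} (hU : IsInvariantNhd U) (x : G) :
    {y | Entourage U x y} ∈ 𝓝 x := by
  have h1 : Continuous fun y : G => -x + y := continuous_const.add continuous_id
  have h2 : Continuous fun y : G => -y + x := continuous_neg.add continuous_const
  refine Filter.inter_mem (h1.continuousAt.preimage_mem_nhds ?_)
    (h2.continuousAt.preimage_mem_nhds ?_) <;>
  simpa [Gyrogroup.neg_add_self] using hU.1

theorem exists_entourage_subset {x : G} {N : Set G} (hN : N ∈ 𝓝 x) :
    ∃ U, IsInvariantNhd U ∧ ∀ y, Entourage U x y → y ∈ N := by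
  have h1 : Continuous fun y : G => x + y := continuous_const.add continuous_id
  have h2 : (fun y : G => x + y) ⁻¹' N ∈ 𝓝 0 :=
    h1.continuousAt.preimage_mem_nhds (by simpa using hN)
  obtain ⟨U, hU, hUN⟩ := exists_isInvariantNhd_subset h2
  refine ⟨U, hU, fun y hy => ?_⟩
  have := hUN hy.1
  rwa [mem_preimage, gyro_add_neg_cancel_left] at this

theorem stronglyTopologicalGyrogroup_regularSpace : RegularSpace G := by
  refine RegularSpace.of_exists_mem_nhds_isClosed_subset fun x s hs => ?_
  obtain ⟨U, hU, hUs⟩ := exists_entourage_subset hs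
  obtain ⟨V, hV, hVU⟩ := exists_entourage_trans hU
  refine ⟨closure {y | Entourage V x y}, Filter.mem_of_superset (entourage_mem_nhds hV x)
    subset_closure, isClosed_closure, fun z hz => hUs z ?_⟩
  obtain ⟨y, hy1, hy2⟩ := mem_closure_iff_nhds.1 hz _ (entourage_mem_nhds hV z)
  exact hVU x y z hy2 hy1.symm

theorem continuous_of_mem_translationGroup {g : Equiv.Perm G} (hg : g ∈ translationGroup G) :
    Continuous g := by
  have h : Continuous g ∧ Continuous (g⁻¹ : Equiv.Perm G) := by
    induction hg using Subgroup.closure_induction with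
    | mem g hg =>
      obtain ⟨a, rfl⟩ := hg
      exact ⟨continuous_const.add continuous_id, continuous_const.add continuous_id⟩
    | one => exact ⟨continuous_id, continuous_id⟩
    | mul g h _ _ ihg ihh =>
      rw [mul_inv_rev]
      exact ⟨ihg.1.comp ihh.1, ihh.2.comp ihg.2⟩
    | inv g _ ih =>
      rw [inv_inv]
      exact ih.symm
  exact h.1

/-- A colouring of `s` by countably many colours with uniformly discrete colour classes. -/
def HasUniformlyDiscreteColoring (s : Set G) : Prop :=
  ∃ (color : G → List ℕ) (U : List ℕ → Set G), (∀ c, IsInvariantNhd (U c)) ∧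
    ∀ x ∈ s, ∀ y ∈ s, x ≠ y → color x = color y → ¬ Entourage (U (color x)) x y

theorem HasUniformlyDiscreteColoring.sigmaDiscretelyExpandable
    (h : HasUniformlyDiscreteColoring (univ : Set G)) : SigmaDiscretelyExpandable G := by
  obtain ⟨color, U, hU, hd⟩ := h
  -- Four links are needed: two balls meeting a third ball around `x` give a chain from `y` to `y'`
  -- through `z`, `x`, `z'`.
  have hV : ∀ c, ∃ V, IsInvariantNhd V ∧ ∀ x y z w v, Entourage V x y → Entourage V y z →
      Entourage V z w → Entourage V w v → Entourage (U c) x v := by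
    intro c
    obtain ⟨V, hV, h1⟩ := exists_entourage_trans (hU c)
    obtain ⟨W, hW, h2⟩ := exists_entourage_trans hV
    exact ⟨W, hW, fun x y z w v ha hb hc hd => h1 _ _ _ (h2 _ _ _ ha hb) (h2 _ _ _ hc hd)⟩
  choose V hV hVU using hV
  have key : ∀ x z y y', color y = color y' → Entourage (V (color y)) y z →
      Entourage (V (color y)) z x → ∀ z', Entourage (V (color y)) x z' →
      Entourage (V (color y)) z' y' → y = y' := by
    intro x z y y' hc h1 h2 z' h3 h4
    by_contra hne
    exact hd y (mem_univ _) y' (mem_univ _) hne hc (hVU _ _ _ _ _ _ h1 h2 h3 h4)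
  refine ⟨fun n => {x | Encodable.encode (color x) = n},
    fun _ y => interior {z | Entourage (V (color y)) y z}, ?_, fun _ _ => isOpen_interior, ?_,
    ?_, ?_⟩
  · exact eq_univ_of_forall fun x => mem_iUnion.2 ⟨_, rfl⟩
  · exact fun n y _ => mem_interior_iff_mem_nhds.2 (entourage_mem_nhds (hV _) y)
  · intro n x
    rcases isEmpty_or_nonempty {x | Encodable.encode (color x) = n} with hE | ⟨⟨y₀, hy₀⟩⟩
    · exact ⟨univ, Filter.univ_mem, toFinite _⟩
    · have hcol : ∀ y : {x | Encodable.encode (color x) = n}, color y = color y₀ := fun y =>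
        Encodable.encode_injective (y.2.trans (Eq.symm hy₀))
      refine ⟨{z | Entourage (V (color y₀)) x z}, entourage_mem_nhds (hV _) x,
        Set.Subsingleton.finite ?_⟩
      rintro y ⟨z, hz1, hz2⟩ y' ⟨z', hz1', hz2'⟩
      have h1 := interior_subset hz1
      have h2 := interior_subset hz1'
      simp only [mem_ofPred_eq, hcol] at h1 h2 hz2 hz2'
      refine Subtype.ext (key x z y y' ((hcol y).trans (hcol y').symm) ?_ ?_ z' ?_ ?_) <;> rw [hcol]
      exacts [h1, hz2.symm, hz2', h2.symm]
  · intro n y hy y' hy' hne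
    refine disjoint_left.2 fun z hz hz' => hne ?_
    have hc : color y = color y' := Encodable.encode_injective (Eq.trans hy (Eq.symm hy'))
    have h1 := interior_subset hz
    have h2 := interior_subset hz'
    simp only [mem_ofPred_eq, ← hc] at h1 h2
    have hrefl := entourage_refl (mem_of_mem_nhds (hV (color y)).1) z
    exact key z z y y' hc h1 hrefl z hrefl h2.symm

/-- A uniformly discrete colouring of an open orbit extends to the whole space. -/
theorem HasUniformlyDiscreteColoring.of_orbit {Γ : Subgroup (Equiv.Perm G)}
    (hΓ : Γ ≤ translationGroup G) (hopen : {x | ∃ g ∈ Γ, g 0 = x} ∈ 𝓝 (0 : G))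
    (h : HasUniformlyDiscreteColoring {x : G | ∃ g ∈ Γ, g 0 = x}) :
    HasUniformlyDiscreteColoring (univ : Set G) := by
  obtain ⟨color, U, hU, hd⟩ := h
  obtain ⟨V, hV, hVX⟩ := exists_isInvariantNhd_subset hopen
  have hwf : WellFounded (WellOrderingRel (α := Equiv.Perm G)) := WellOrderingRel.isWellOrder.wf
  let S : G → Set (Equiv.Perm G) := fun y => {t | t ∈ translationGroup G ∧ ∃ g ∈ Γ, g 0 = t⁻¹ y}
  have hS : ∀ y, (S y).Nonempty := by
    intro y
    refine ⟨leftTranslation y, Subgroup.subset_closure ⟨y, rfl⟩, 1, one_mem _, ?_⟩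
    exact (Gyrogroup.neg_add_self y).symm
  let T : G → Equiv.Perm G := fun y => hwf.min (S y) (hS y)
  have hT : ∀ y, T y ∈ S y := fun y => hwf.min_mem _ _
  have hmin : ∀ y, ∀ t ∈ S y, ¬ WellOrderingRel t (T y) := fun y t ht => hwf.not_lt_min _ ht
  -- Moving `x` to `0` takes `y` into `V`, inside the orbit, so `y` already lies in the copy given
  -- by `T x`, against the minimality of `T y`.
  have hlt : ∀ x y, WellOrderingRel (T x) (T y) → ¬ Entourage V x y := by
    intro x y hxy hent
    obtain ⟨hTx, g, hg, hgx⟩ := hT x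
    have hmem := mul_mem hTx (hΓ hg)
    have hx : (T x * g) 0 = x := by rw [Equiv.Perm.mul_apply, hgx, perm_apply_inv]
    have h1 : Entourage V 0 ((T x * g)⁻¹ y) := by
      rwa [← entourage_translate hV.2 hmem, hx, perm_apply_inv]
    obtain ⟨k, hk, hky⟩ := hVX h1.mem
    refine hmin y (T x) ⟨hTx, g * k, mul_mem hg hk, ?_⟩ hxy
    rw [Equiv.Perm.mul_apply, hky, mul_inv_rev, Equiv.Perm.mul_apply, perm_apply_inv]
  refine ⟨fun y => color ((T y)⁻¹ y), fun c => U c ∩ V, fun c => (hU c).inter hV, ?_⟩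
  intro x _ y _ hne hc hent
  rcases trichotomous_of (WellOrderingRel (α := Equiv.Perm G)) (T x) (T y) with h | h | h
  · exact hlt x y h (hent.mono inter_subset_right)
  · refine hd _ (hT x).2 _ (hT y).2 ?_ hc ?_
    · rw [h]
      exact fun h' => hne ((T y)⁻¹.injective h')
    · rw [← entourage_translate (hU _).2 (hT x).1, perm_apply_inv]
      nth_rw 2 [h]
      rw [perm_apply_inv]
      exact hent.mono inter_subset_left
  · exact hlt y x h (hent.mono inter_subset_right).symm

end Topological

/-! ### Submaximal spaces and the size of generated groups -/

theorem IsSubmaximal.isClosed_of_interior_eq_empty {X : Type u} [TopologicalSpace X]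
    (hX : IsSubmaximal X) {s : Set X} (hs : interior s = ∅) : IsClosed s :=
  ⟨hX _ (interior_eq_empty_iff_dense_compl.1 hs)⟩

theorem IsSubmaximal.interior_union_eq_empty {X : Type u} [TopologicalSpace X]
    (hX : IsSubmaximal X) {s t : Set X} (hs : interior s = ∅) (ht : interior t = ∅) :
    interior (s ∪ t) = ∅ := by
  rw [interior_union_isClosed_of_interior_empty (hX.isClosed_of_interior_eq_empty hs) ht, hs]

theorem Subgroup.mk_closure_le {M : Type u} [Group M] (s : Set M) :
    Cardinal.mk (Subgroup.closure s) ≤ max (Cardinal.mk s) Cardinal.aleph0 := by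
  rcases isEmpty_or_nonempty s with hs | hs
  · rw [isEmpty_coe_sort.1 hs, Subgroup.closure_empty]
    exact le_max_of_le_right (Cardinal.mk_le_aleph0)
  · rw [← Cardinal.mk_freeGroup, FreeGroup.closure_eq_range]
    exact Cardinal.mk_le_of_surjective (MonoidHom.rangeRestrict_surjective _)

theorem mk_orbit_closure_le {α : Type u} (s : Set (Equiv.Perm α)) (o : α) :
    Cardinal.mk {x | ∃ g ∈ Subgroup.closure s, g o = x} ≤
      max (Cardinal.mk s) Cardinal.aleph0 := by
  refine le_trans ?_ (Subgroup.mk_closure_le s)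
  refine Cardinal.mk_le_of_surjective
    (f := fun g : Subgroup.closure s => ⟨g.1 o, g.1, g.2, rfl⟩) ?_
  rintro ⟨x, g, hg, rfl⟩
  exact ⟨⟨g, hg⟩, rfl⟩

/-- A word uses finitely many generators, hence has a largest index; the identity needs none. -/
theorem mem_closure_image_Iic {M ι : Type*} [Group M] [LinearOrder ι] (T : ι → M) {s : Set ι}
    {g : M} (hg : g ∈ Subgroup.closure (T '' s)) :
    g = 1 ∨ ∃ b ∈ s, g ∈ Subgroup.closure (T '' Iic b) := by
  induction hg using Subgroup.closure_induction with
  | mem g hg =>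
    obtain ⟨b, hb, rfl⟩ := hg
    exact Or.inr ⟨b, hb, Subgroup.subset_closure ⟨b, le_rfl, rfl⟩⟩
  | one => exact Or.inl rfl
  | mul g h _ _ ihg ihh =>
    rcases ihg with rfl | ⟨b, hb, hgb⟩
    · rwa [one_mul]
    rcases ihh with rfl | ⟨c, hc, hhc⟩
    · rw [mul_one]
      exact Or.inr ⟨b, hb, hgb⟩
    have hmono : ∀ d, d ≤ max b c →
        Subgroup.closure (T '' Iic d) ≤ Subgroup.closure (T '' Iic (max b c)) := fun d hd =>
      Subgroup.closure_mono (image_mono (Iic_subset_Iic.2 hd))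
    refine Or.inr ⟨max b c, ?_, mul_mem (hmono b (le_max_left _ _) hgb)
      (hmono c (le_max_right _ _) hhc)⟩
    rcases max_choice b c with h | h <;> rwa [h]
  | inv g _ ih =>
    rcases ih with rfl | ⟨b, hb, hgb⟩
    · exact Or.inl inv_one
    · exact Or.inr ⟨b, hb, inv_mem hgb⟩

/-! ### Colouring a submaximal strongly topological gyrogroup -/

section Coloring

variable {G : Type u} [TopologicalSpace G] [Gyrogroup G]

theorem hasUniformlyDiscreteColoring_of_isOpen_singleton (h : IsOpen ({0} : Set G)) :
    HasUniformlyDiscreteColoring (univ : Set G) := by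
  refine ⟨fun _ => [], fun _ => {0}, fun _ => ⟨h.mem_nhds rfl, fun a b z => ?_⟩, ?_⟩
  · rw [mem_singleton_iff, mem_singleton_iff, map_eq_zero_iff _ (Gyrogroup.gyr a b).injective]
  · exact fun x _ y _ hne _ hent => hne (eq_of_gyro_neg_add_eq_zero hent.1)

theorem hasUniformlyDiscreteColoring_of_countable {s : Set G} (hs : s.Countable) :
    HasUniformlyDiscreteColoring s := by
  obtain ⟨f, hf⟩ := countable_iff_exists_injOn.1 hs
  refine ⟨fun x => [f x], fun _ => univ, fun _ => ⟨Filter.univ_mem, fun _ _ _ => Iff.rfl⟩, ?_⟩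
  intro x hx y hy hne hc
  exact (hne (hf hx hy (List.singleton_injective hc))).elim

variable [IsStronglyTopologicalGyrogroup G]

theorem isOpen_orbit_of_leftTranslation {W : Set G} (hW : IsOpen W) (hne : W.Nonempty) :
    IsOpen {x : G | ∃ g ∈ Subgroup.closure (leftTranslation '' W), g 0 = x} := by
  have hsub : Subgroup.closure (leftTranslation '' W) ≤ translationGroup G :=
    Subgroup.closure_mono (image_subset_range _ _)
  have hWX : ∀ b ∈ W, ∃ h ∈ Subgroup.closure (leftTranslation '' W), h 0 = b := fun b hb =>
    ⟨leftTranslation b, Subgroup.subset_closure ⟨b, hb, rfl⟩, add_zero b⟩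
  obtain ⟨b, hb⟩ := hne
  obtain ⟨h, hh, hhb⟩ := hWX b hb
  rw [isOpen_iff_mem_nhds]
  rintro x ⟨g, hg, rfl⟩
  have hk := mul_mem hh (inv_mem hg)
  have hcont := continuous_of_mem_translationGroup (hsub hk)
  have hval : (h * g⁻¹) (g 0) = b := by
    rw [Equiv.Perm.mul_apply, perm_inv_apply, hhb]
  have hmem : (h * g⁻¹) ⁻¹' W ∈ 𝓝 (g 0) :=
    hcont.continuousAt.preimage_mem_nhds (hval ▸ hW.mem_nhds hb)
  refine Filter.mem_of_superset hmem fun y hy => ?_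
  obtain ⟨l, hl, hly⟩ := hWX _ hy
  refine ⟨(h * g⁻¹)⁻¹ * l, mul_mem (inv_mem hk) hl, ?_⟩
  rw [Equiv.Perm.mul_apply, hly, perm_inv_apply]

/-- A rank function on a submaximal gyrogroup, constant on small translates and with nowhere dense
initial segments, sends the punctured neighbourhoods of zero to a free ultrafilter; if there are no
measurable cardinals it can be composed with a map to `ℕ` so as to diverge at zero. -/
theorem exists_nat_map_tendsto_of_rank (hmeas : ¬ ∃ m : Cardinal.{u}, IsMeasurableCardinal m)
    (hG : IsSubmaximal G) (h0 : ¬ IsOpen ({0} : Set G)) {ι : Type u} (rank : G → ι)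
    (X : Set G) (hX : X ∈ 𝓝 (0 : G)) (D : ι → Set G) (hD : ∀ a, interior (D a) = ∅)
    (hrankD : ∀ x ∈ X, x ≠ 0 → x ∈ D (rank x))
    (htrans : ∀ y ∈ X, ∃ g ∈ translationGroup G, ∃ a, g 0 = y ∧
      ∀ x ∈ X, x ∉ D a → rank (g x) = rank x) :
    ∃ r : ι → ℕ, ∀ n, {x | x = 0 ∨ n < r (rank x)} ∈ 𝓝 (0 : G) := by
  -- By submaximality `D a \ {0}` is closed, so its complement is a neighbourhood of `0`.
  have hDnhd : ∀ a, ∀ᶠ x in 𝓝[≠] (0 : G), x ∉ D a := by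
    intro a
    have h1 : interior (D a \ {0}) = ∅ :=
      subset_empty_iff.1 ((interior_mono sdiff_subset).trans (hD a).subset)
    have h2 : (D a \ {0})ᶜ ∈ 𝓝 (0 : G) :=
      (hG.isClosed_of_interior_eq_empty h1).isOpen_compl.mem_nhds fun h => h.2 rfl
    filter_upwards [mem_nhdsWithin_of_mem_nhds h2, self_mem_nhdsWithin] with x hx hx0 hxD
    exact hx ⟨hxD, hx0⟩
  have hXnhd : ∀ᶠ x in 𝓝[≠] (0 : G), x ∈ X := mem_nhdsWithin_of_mem_nhds hX
  let f : Filter ι := (𝓝[≠] (0 : G)).map rank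
  have hne : (𝓝[≠] (0 : G)).NeBot := by
    rw [Filter.neBot_iff]
    exact fun h => h0 (isOpen_singleton_iff_punctured_nhds 0 |>.2 h)
  -- An interior point is carried to `0` by a translation that leaves the rank unchanged off one set
  -- `D a`, which is negligible near `0`.
  have hpos : ∀ S : Set ι, (interior (X ∩ rank ⁻¹' S)).Nonempty → S ∈ f := by
    rintro S ⟨y, hy⟩
    obtain ⟨g, hg, a, hgy, hga⟩ := htrans y (interior_subset hy).1
    have h1 : g ⁻¹' interior (X ∩ rank ⁻¹' S) ∈ 𝓝 0 :=
      (continuous_of_mem_translationGroup hg).continuousAt.preimage_mem_nhds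
        (hgy ▸ isOpen_interior.mem_nhds hy)
    rw [Filter.mem_map]
    filter_upwards [mem_nhdsWithin_of_mem_nhds h1, hXnhd, hDnhd a] with x hx1 hx2 hx3
    have := (interior_subset hx1).2
    rwa [mem_preimage, hga x hx2 hx3] at this
  -- Sets with empty interior form an ideal, so `rank ⁻¹' S` or its complement has interior in `X`;
  -- hence `f` is an ultrafilter.
  have hor : ∀ S : Set ι, S ∈ f ∨ Sᶜ ∈ f := by
    intro S
    by_contra! h
    have h1 : interior (X ∩ rank ⁻¹' S) = ∅ :=
      not_nonempty_iff_eq_empty.1 fun h' => h.1 (hpos S h')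
    have h2 : interior (X ∩ rank ⁻¹' Sᶜ) = ∅ :=
      not_nonempty_iff_eq_empty.1 fun h' => h.2 (hpos _ h')
    have h3 := hG.interior_union_eq_empty h1 h2
    rw [← inter_union_distrib_left, ← preimage_union, union_compl_self, preimage_univ,
      inter_univ] at h3
    exact (h3 ▸ mem_interior_iff_mem_nhds.2 hX : (0 : G) ∈ (∅ : Set G))
  let q : Ultrafilter ι := Ultrafilter.ofComplNotMemIff f fun S =>
    ⟨fun h => (hor S).resolve_right h, fun h h' => by
      have h3 := Filter.inter_mem h h'
      rw [inter_compl_self, Filter.mem_map, preimage_empty] at h3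
      exact Filter.empty_notMem _ h3⟩
  have hq : ∀ S, S ∈ q ↔ S ∈ f := fun S => Iff.rfl
  have hfree : ∀ a, {a} ∉ q := by
    intro a
    rw [← Ultrafilter.compl_mem_iff_notMem, hq, Filter.mem_map]
    filter_upwards [hDnhd a, hXnhd, self_mem_nhdsWithin] with x hx1 hx2 hx3 hx4
    rw [mem_singleton_iff] at hx4
    exact hx1 (hx4 ▸ hrankD x hx2 hx3)
  obtain ⟨r, hr⟩ := exists_nat_map_of_no_measurable hmeas q hfree
  refine ⟨r, fun n => ?_⟩
  have h1 := mem_nhdsWithin_iff_eventually.1 ((hq _).1 (hr n))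
  filter_upwards [h1] with x hx
  by_cases hx0 : x = 0
  · exact Or.inl hx0
  · exact Or.inr (hx hx0)

theorem hasUniformlyDiscreteColoring_of_uncountable
    (hmeas : ¬ ∃ m : Cardinal.{u}, IsMeasurableCardinal m) (hG : IsSubmaximal G)
    (h0 : ¬ IsOpen ({0} : Set G)) {W : Set G} (hW : IsOpen W)
    (hWc : Cardinal.aleph0 < Cardinal.mk W)
    (hmin : ∀ V : Set G, IsOpen V → V.Nonempty → Cardinal.mk W ≤ Cardinal.mk V) :
    HasUniformlyDiscreteColoring
      {x : G | ∃ g ∈ Subgroup.closure (leftTranslation '' W), g 0 = x} := by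
  classical
  -- Indexing by the initial ordinal makes every proper initial segment smaller than `W`.
  obtain ⟨e⟩ : Nonempty ((Cardinal.mk W).ord.ToType ≃ W) := Cardinal.eq.1 (Cardinal.mk_ord_toType _)
  have hseg : ∀ a : (Cardinal.mk W).ord.ToType, Cardinal.mk (Iio a) < Cardinal.mk W := fun a => by
    simpa using Cardinal.mk_Iio_lt a (by simp)
  set ι := (Cardinal.mk W).ord.ToType
  have hWne : W.Nonempty :=
    nonempty_coe_sort.1 (Cardinal.mk_ne_zero_iff.1 (Cardinal.aleph0_pos.trans hWc).ne')
  have : Nonempty ι := ⟨e.symm ⟨_, hWne.choose_spec⟩⟩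
  let T : ι → Equiv.Perm G := fun a => leftTranslation (e a).1
  have hTW : T '' univ = leftTranslation '' W := by
    ext g
    constructor
    · rintro ⟨a, -, rfl⟩
      exact ⟨_, (e a).2, rfl⟩
    · rintro ⟨b, hb, rfl⟩
      exact ⟨e.symm ⟨b, hb⟩, trivial, by simp [T]⟩
  set Γ := Subgroup.closure (leftTranslation '' W) with hΓ
  let Gle : ι → Subgroup (Equiv.Perm G) := fun a => Subgroup.closure (T '' Iic a)
  let Glt : ι → Subgroup (Equiv.Perm G) := fun a => Subgroup.closure (T '' Iio a)
  have hGle : ∀ a, Gle a ≤ Γ := fun a => by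
    rw [hΓ, ← hTW]
    exact Subgroup.closure_mono (image_mono (subset_univ _))
  have hΓt : Γ ≤ translationGroup G := Subgroup.closure_mono (image_subset_range _ _)
  have hlt_le : ∀ a, Glt a ≤ Gle a := fun a => Subgroup.closure_mono (image_mono Iio_subset_Iic_self)
  have hle_lt : ∀ a b, a < b → Gle a ≤ Glt b := fun a b hab =>
    Subgroup.closure_mono (image_mono (Iic_subset_Iio.2 hab))
  have hlt : ∀ a, ∀ g ∈ Glt a, g 0 = 0 ∨ ∃ b < a, ∃ k ∈ Gle b, k 0 = g 0 := by
    intro a g hg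
    rcases mem_closure_image_Iic T hg with rfl | ⟨b, hb, hgb⟩
    · exact Or.inl rfl
    · exact Or.inr ⟨b, hb, g, hgb, rfl⟩
  have hΓle : ∀ g ∈ Γ, ∃ a, g ∈ Gle a := by
    intro g hg
    rw [hΓ, ← hTW] at hg
    rcases mem_closure_image_Iic T hg with rfl | ⟨b, -, hgb⟩
    · exact ⟨Classical.arbitrary ι, one_mem _⟩
    · exact ⟨b, hgb⟩
  let P : ι → G → Prop := fun a x => (∃ g ∈ Gle a, g 0 = x) ∧ ¬ ∃ g ∈ Glt a, g 0 = x
  have hP : ∀ x, (∃ g ∈ Γ, g 0 = x) → x ≠ 0 → ∃ a, P a x := by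
    rintro x ⟨g, hg, hgx⟩ hx
    obtain ⟨a, ha⟩ := hΓle g hg
    exact exists_chain_stage hlt ⟨a, g, ha, hgx⟩ hx
  have hPlt : ∀ a b x, P a x → P b x → ¬ a < b := by
    rintro a b x ⟨⟨g, hg, hgx⟩, -⟩ ⟨-, h⟩ hab
    exact h ⟨g, hle_lt a b hab hg, hgx⟩
  let rank : G → ι := fun x => if h : ∃ a, P a x then h.choose else Classical.arbitrary ι
  have hrank : ∀ a x, P a x → rank x = a := by
    intro a x h
    have hex : ∃ a, P a x := ⟨a, h⟩
    have h1 : P (rank x) x := by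
      simp only [rank, dif_pos hex]
      exact hex.choose_spec
    exact le_antisymm (not_lt.1 (hPlt _ _ _ h h1)) (not_lt.1 (hPlt _ _ _ h1 h))
  have hsmall : ∀ a, interior {x | ∃ g ∈ Gle a, g 0 = x} = ∅ := by
    intro a
    by_contra hne
    have h1 := hmin _ isOpen_interior (nonempty_iff_ne_empty.2 hne)
    refine not_lt.2 h1 (lt_of_le_of_lt (Cardinal.mk_le_mk_of_subset interior_subset) ?_)
    refine lt_of_le_of_lt (mk_orbit_closure_le _ _) (max_lt ?_ hWc)
    refine lt_of_le_of_lt Cardinal.mk_image_le ?_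
    rw [← Iio_insert]
    refine lt_of_le_of_lt Cardinal.mk_insert_le ?_
    exact Cardinal.add_lt_of_lt hWc.le (hseg a) (Cardinal.one_lt_aleph0.trans hWc)
  obtain ⟨r, hr⟩ := exists_nat_map_tendsto_of_rank hmeas hG h0 rank {x | ∃ g ∈ Γ, g 0 = x}
    ((isOpen_orbit_of_leftTranslation hW hWne).mem_nhds ⟨1, one_mem _, rfl⟩)
    (fun a => {x | ∃ g ∈ Gle a, g 0 = x}) hsmall
    (fun x hx hx0 => by
      obtain ⟨a, ha⟩ := hP x hx hx0
      rw [hrank a x ha]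
      exact ha.1)
    (by
      rintro y ⟨g, hg, hgy⟩
      obtain ⟨b, hb⟩ := hΓle g hg
      refine ⟨g, hΓt hg, b, hgy, fun x hx hxb => ?_⟩
      have hx0 : x ≠ 0 := by
        rintro rfl
        exact hxb ⟨1, one_mem _, rfl⟩
      obtain ⟨a, ha⟩ := hP x hx hx0
      have hba : b < a := by
        by_contra hab
        obtain ⟨k, hk, hkx⟩ := ha.1
        exact hxb ⟨k, Subgroup.closure_mono (image_mono (Iic_subset_Iic.2 (not_lt.1 hab))) hk, hkx⟩
      -- `g` lies in both `Glt a` and `Gle a`, so it preserves the stage at which `x` enters.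
      have hga := hle_lt b a hba hb
      rw [hrank a x ha]
      refine hrank a _ ⟨?_, ?_⟩
      · obtain ⟨k, hk, hkx⟩ := ha.1
        exact ⟨g * k, mul_mem (hlt_le a hga) hk, by rw [Equiv.Perm.mul_apply, hkx]⟩
      · rintro ⟨k, hk, hkx⟩
        refine ha.2 ⟨g⁻¹ * k, mul_mem (inv_mem hga) hk, ?_⟩
        rw [Equiv.Perm.mul_apply, hkx, perm_inv_apply])
  obtain ⟨color, hcolor⟩ := exists_chain_coloring (0 : G) Gle Glt Γ hGle hlt_le hle_lt hlt r rank
    fun a x h1 h2 => hrank a x ⟨h1, h2⟩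
  have hU : ∀ n, ∃ U : Set G, IsInvariantNhd U ∧ U ⊆ {x | x = 0 ∨ n < r (rank x)} := fun n =>
    exists_isInvariantNhd_subset (hr n)
  choose U hU hUr using hU
  have hX : ∀ x, (∃ g ∈ Γ, g 0 = x) → ∃ a, ∃ g ∈ Gle a, g 0 = x := by
    rintro x ⟨g, hg, hgx⟩
    obtain ⟨a, ha⟩ := hΓle g hg
    exact ⟨a, g, ha, hgx⟩
  -- The sum bounds every entry of the list, in particular `r (rank z)`.
  refine ⟨color, fun c => U c.sum, fun c => hU _, ?_⟩
  intro x hx y hy hne hc hent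
  obtain ⟨g, hg, z, hz0, hzr, hz⟩ := hcolor x y (hX x hx) (hX y hy) hne hc
  have hz' : Entourage (U (color x).sum) 0 z := by
    rw [← entourage_translate (hU _).2 (hΓt hg)]
    rcases hz with ⟨h1, h2⟩ | ⟨h1, h2⟩
    · rwa [h1, h2]
    · rw [h1, h2]
      exact hent.symm
  rcases hUr _ hz'.mem with h | h
  · exact hz0 h
  · exact absurd h (not_lt.2 (List.le_sum_of_mem hzr))

theorem hasUniformlyDiscreteColoring_univ
    (hmeas : ¬ ∃ m : Cardinal.{u}, IsMeasurableCardinal m) (hG : IsSubmaximal G) :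
    HasUniformlyDiscreteColoring (univ : Set G) := by
  by_cases h0 : IsOpen ({0} : Set G)
  · exact hasUniformlyDiscreteColoring_of_isOpen_singleton h0
  obtain ⟨W, ⟨hW, hWne⟩, hmin⟩ := (InvImage.wf (fun V : Set G => Cardinal.mk V)
    Cardinal.lt_wf).has_min {V | IsOpen V ∧ V.Nonempty} ⟨univ, isOpen_univ, ⟨0, trivial⟩⟩
  have hmin' : ∀ V : Set G, IsOpen V → V.Nonempty → Cardinal.mk W ≤ Cardinal.mk V :=
    fun V hV hVne => not_lt.1 (hmin V ⟨hV, hVne⟩)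
  refine HasUniformlyDiscreteColoring.of_orbit (Γ := Subgroup.closure (leftTranslation '' W))
    (Subgroup.closure_mono (image_subset_range _ _))
    ((isOpen_orbit_of_leftTranslation hW hWne).mem_nhds ⟨1, one_mem _, rfl⟩) ?_
  rcases lt_or_ge Cardinal.aleph0 (Cardinal.mk W) with h | h
  · exact hasUniformlyDiscreteColoring_of_uncountable hmeas hG h0 hW h hmin'
  · refine hasUniformlyDiscreteColoring_of_countable (Cardinal.le_aleph0_iff_set_countable.1 ?_)
    exact (mk_orbit_closure_le _ _).trans (max_le (Cardinal.mk_image_le.trans h) le_rfl)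

end Coloring

theorem mainTheorem8
    (hmeas : ¬ ∃ m : Cardinal.{u}, IsMeasurableCardinal m) :
    (∀ (G : Type u) [TopologicalSpace G] [T2Space G] [Gyrogroup G]
      [IsStronglyTopologicalGyrogroup G], IsSubmaximal G →
        IsHereditarilyParacompact G ∧ coveringDim G = 0) ∧
    (∀ (G : Type u) [TopologicalSpace G] [T2Space G] [Gyrogroup G]
      [IsStronglyTopologicalGyrogroup G], IsSubmaximal G → Infinite G →
        ¬ ConnectedSpace G) := by
  refine ⟨?_, ?_⟩
  · intro G _ _ _ _ hG
    have hreg : RegularSpace G := stronglyTopologicalGyrogroup_regularSpace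
    have hexp := (hasUniformlyDiscreteColoring_univ hmeas hG).sigmaDiscretelyExpandable
    have : Nonempty G := ⟨0⟩
    exact ⟨fun s => ⟨inferInstance, (hexp.subtype s).paracompactSpace⟩,
      coveringDim_eq_zero hexp.coveringDimLE_zero⟩
  · intro G _ _ _ _ hG _ hconn
    have hreg : RegularSpace G := stronglyTopologicalGyrogroup_regularSpace
    have hexp := (hasUniformlyDiscreteColoring_univ hmeas hG).sigmaDiscretelyExpandable
    obtain ⟨a, ha⟩ := exists_ne (0 : G)
    obtain ⟨C, hC, h0C, hCa⟩ :=
      hexp.exists_isClopen_subset (isOpen_compl_singleton.mem_nhds ha.symm)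
    rcases isClopen_iff.1 hC with rfl | rfl
    · exact h0C
    · exact hCa (mem_univ a) rfl
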